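/- Let $m,n$ be natural numbers, $A\in\mathbb{R}^{n\times n}$, and $C_i\in\mathbb{R}^{s_i\times n}$ for $i\in\{1,\dots,m\}$. Consider the discrete-time system $x(\tau+1)=Ax(\tau)$, $\tau=0,1,2,\dots$, where agent $i$ measures $y_i(\tau)=C_ix(\tau)$. Suppose that it is jointly observable, i.e. that the pair $(C,A)$, with $C$ the matrix obtained by stacking $C_1,\dots,C_m$, is observable. Let $P_i$ be the orthogonal projection of $\mathbb{R}^n$ on the unobservable space $\bigcap_{k=0}^{n-1}\ker C_iA^k$ of $(C_i,A)$. A neighbor graph $\mathbb{N}$ is a directed graph on $\{1,\dots,m\}$ with a self-arc at each vertex. It has an arc from $j$ to $i$ exactly when $j$ is a neighbor of $i$; $\mathcal{N}_i$ denotes the set of neighbors of $i$ (so $i\in\mathcal{N}_i$) and $m_i$ the number of its elements. Let $\mathbb{N}(\tau)$ be the neighbor graph in force between the event times $\tau$ and $\tau+1$, with neighbor sets $\mathcal{N}_i(\tau)$ of cardinality $m_i(\tau)$. For matrices $K_i\in\mathbb{R}^{n\times s_i}$ and an integer $q\ge 0$ consider the two-time-scale estimator in which agent $i$ updates its estimate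 $x_i(\tau)$ of $x(\tau)$, starting from an arbitrary $x_i(0)$, by $$z_i(0,\tau)=x_i(\tau),\qquad z_i(k,\tau)=(I-P_i)z_i(k-1,\tau)+\frac{1}{m_i(\tau)}P_i\sum_{j\in\mathcal{N}_i(\tau)}z_j(k-1,\tau),\quad k=1,\dots,q,$$ $$x_i(\tau+1)=(A+K_iC_i)z_i(q,\tau)-K_iy_i(\tau).$$ Then for every real $\lambda$ with $0<|\lambda|<1$ there are matrices $K_1,\dots,K_m$ such that the following two statements hold. (a) If the neighbor graph is fixed, $\mathbb{N}(\tau)=\mathbb{N}$ for all $\tau$, and strongly connected, then for all sufficiently large $q$ (depending on $\mathbb{N}$) and all initial states $x(0),x_1(0),\dots,x_m(0)$, each estimation error converges to zero as fast as $\lambda^\tau$, i.e. $x_i(\tau)-x(\tau)=O(|\lambda|^\tau)$ as $\tau\to\infty$. (b) There is a $q_0$ such that for every $q\ge q_0$, every sequence $\mathbb{N}(0),\mathbb{N}(1),\dots$ of strongly connected neighbor graphs, and all initial states, $x_i(\tau)-x(\tau)=O(|\lambda|^\tau)$ as $\tau\to\infty$ for each $i$. -/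

import Mathlib

open Filter Asymptotics

noncomputable section

/-- The action of a real matrix on column vectors, as a linear map between Euclidean spaces. -/
abbrev matAct {ι κ : Type*} [Fintype κ] [DecidableEq κ]
    (M : Matrix ι κ ℝ) : EuclideanSpace ℝ κ →ₗ[ℝ] EuclideanSpace ℝ ι :=
  Matrix.toEuclideanLin M

/-- The observability matrix of `(C, A)`: the blocks `C`, `C A`, ..., `C A ^ (n - 1)` stacked. -/
def observabilityMatrix {p : Type*} {n : ℕ} (C : Matrix p (Fin n) ℝ)
    (A : Matrix (Fin n) (Fin n) ℝ) : Matrix (Fin n × p) (Fin n) ℝ :=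
  Matrix.of fun ka j => (C * A ^ (ka.1 : ℕ)) ka.2 j

/-- The unobservable space of `(C, A)`: the kernel of the observability matrix. -/
def unobservableSpace {p : Type*} {n : ℕ} (C : Matrix p (Fin n) ℝ)
    (A : Matrix (Fin n) (Fin n) ℝ) : Submodule ℝ (EuclideanSpace ℝ (Fin n)) :=
  LinearMap.ker (matAct (observabilityMatrix C A))

/-- The pair `(C, A)` is observable: its observability matrix has trivial kernel. -/
def IsObservable {p : Type*} {n : ℕ} (C : Matrix p (Fin n) ℝ)
    (A : Matrix (Fin n) (Fin n) ℝ) : Prop :=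
  unobservableSpace C A = ⊥

/-- The matrix obtained by stacking the output matrices of all agents. -/
def stackedOutput {m n : ℕ} {s : Fin m → ℕ} (C : ∀ i, Matrix (Fin (s i)) (Fin n) ℝ) :
    Matrix (Σ i, Fin (s i)) (Fin n) ℝ :=
  Matrix.of fun ia j => C ia.1 ia.2 j

/-- The system `x (τ + 1) = A x τ`, `y_i τ = C_i x τ` is jointly observable. -/
def JointlyObservable {m n : ℕ} {s : Fin m → ℕ} (C : ∀ i, Matrix (Fin (s i)) (Fin n) ℝ)
    (A : Matrix (Fin n) (Fin n) ℝ) : Prop :=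
  IsObservable (stackedOutput C) A

/-- A neighbor graph on `m` agents, given by the sets of neighbors; every agent is a neighbor
of itself. -/
structure NeighborGraph (m : ℕ) where
  nbr : Fin m → Finset (Fin m)
  self_mem : ∀ i, i ∈ nbr i

/-- There is an arc from `j` to `i` whenever `j` is a neighbor of `i`. -/
def NeighborGraph.Arc {m : ℕ} (N : NeighborGraph m) (j i : Fin m) : Prop :=
  j ∈ N.nbr i

/-- There is a directed path from every vertex to every vertex. -/
def NeighborGraph.StronglyConnected {m : ℕ} (N : NeighborGraph m) : Prop :=
  ∀ i j : Fin m, Relation.ReflTransGen N.Arc i j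

/-- One step of the inner (consensus) iteration:
`z_i ↦ (I - P_i) z_i + (1 / m_i) P_i ∑_{j ∈ N_i} z_j`, with `P_i` the orthogonal projection on the
unobservable space of `(C_i, A)` and `m_i` the number of neighbors of agent `i`. -/
def consensusStep {m n : ℕ} {s : Fin m → ℕ} (A : Matrix (Fin n) (Fin n) ℝ)
    (C : ∀ i, Matrix (Fin (s i)) (Fin n) ℝ) (N : NeighborGraph m)
    (z : Fin m → EuclideanSpace ℝ (Fin n)) : Fin m → EuclideanSpace ℝ (Fin n) := fun i =>
  (z i - (unobservableSpace (C i) A).starProjection (z i)) +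
    (1 / ((N.nbr i).card : ℝ)) •
      (unobservableSpace (C i) A).starProjection (∑ j ∈ N.nbr i, z j)

/-- `x` is a trajectory of the system `x (τ + 1) = A x τ`, and `xh τ i` is the estimate computed by
agent `i` at event time `τ` by the two-time-scale estimator with gains `K`, with `q` consensus steps
between successive event times and with neighbor graph `N τ` between the event times
`τ` and `τ + 1`. The initial states are arbitrary. -/
structure IsEstimatorRun {m n : ℕ} {s : Fin m → ℕ} (A : Matrix (Fin n) (Fin n) ℝ)
    (C : ∀ i, Matrix (Fin (s i)) (Fin n) ℝ) (K : ∀ i, Matrix (Fin n) (Fin (s i)) ℝ)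
    (q : ℕ) (N : ℕ → NeighborGraph m)
    (x : ℕ → EuclideanSpace ℝ (Fin n)) (xh : ℕ → Fin m → EuclideanSpace ℝ (Fin n)) : Prop where
  plant : ∀ τ, x (τ + 1) = matAct A (x τ)
  update : ∀ τ i, xh (τ + 1) i =
    matAct (A + K i * C i) (((consensusStep A C (N τ))^[q] (xh τ)) i) -
      matAct (K i) (matAct (C i) (x τ))

end

/-! Let V_i be the unobservable space of (C_i, A). Consensus moves agent i's error only along V_i,
and A + K_i C_i preserves V_i. So modulo V_i each agent runs its own local observer, and a deadbeat
gain (`exists_deadbeat_observer`) brings every error into V_i in finite time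
(`IsEstimatorRun.error_sub_pow_mem`).

From then on a consensus step is `projectedAverage`, which is nonexpansive for the maximum norm over
agents. On a strongly connected graph, a tuple that keeps its norm long enough is constant with
value in every V_i, hence zero by joint observability; by compactness some power is a strict
contraction. As there are finitely many graphs, one threshold on q makes the inner loop outweigh the
norms of all A + K_i C_i, leaving a factor |λ| per event time. -/

/-! ### Deadbeat observers. -/

namespace LinearMap

variable {𝕜 X Y : Type*} [Field 𝕜] [AddCommGroup X] [Module 𝕜 X] [AddCommGroup Y] [Module 𝕜 Y]

/-- A linear map has a linear section over the image of any given subspace, with values in that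
subspace. -/
theorem exists_section_map (C : X →ₗ[𝕜] Y) (U : Submodule 𝕜 X) :
    ∃ h : Y →ₗ[𝕜] X, ∀ y ∈ U.map C, h y ∈ U ∧ C (h y) = y := by
  obtain ⟨r, hr⟩ := ((C.domRestrict U).rangeRestrict).exists_rightInverse_of_surjective
    (LinearMap.range_rangeRestrict _)
  obtain ⟨h, hh⟩ := LinearMap.exists_extend (U.subtype ∘ₗ r)
  refine ⟨h, fun y hy => ?_⟩
  have hy' : y ∈ LinearMap.range (C.domRestrict U) := by
    obtain ⟨x, hx, rfl⟩ := hy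
    exact ⟨⟨x, hx⟩, rfl⟩
  have h1 : h y = (r ⟨y, hy'⟩ : X) := LinearMap.congr_fun hh ⟨y, hy'⟩
  have h2 := congrArg Subtype.val (LinearMap.congr_fun hr ⟨y, hy'⟩)
  rw [h1]
  exact ⟨(r ⟨y, hy'⟩).2, h2⟩

/-- A section of a linear map can be chosen compatibly with a finite decreasing chain of
subspaces. -/
theorem exists_section_map_chain (C : X →ₗ[𝕜] Y) (N : ℕ) :
    ∀ U : ℕ → Submodule 𝕜 X, Antitone U →
      ∃ g : Y →ₗ[𝕜] X, ∀ k < N, ∀ y ∈ (U k).map C, g y ∈ U k ∧ C (g y) = y := by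
  induction N with
  | zero => exact fun U _ => ⟨0, fun k hk => absurd hk (Nat.not_lt_zero k)⟩
  | succ N ih =>
    intro U hU
    obtain ⟨g, hg⟩ := ih (fun k => U (k + 1)) fun a b hab => hU (Nat.succ_le_succ hab)
    obtain ⟨h, hh⟩ := C.exists_section_map (U 0)
    rcases Nat.eq_zero_or_pos N with rfl | hN
    · refine ⟨h, fun k hk => ?_⟩
      obtain rfl : k = 0 := by omega
      exact hh
    obtain ⟨p, hp⟩ := ((U 1).map C).subtype.exists_leftInverse_of_injective
      (LinearMap.ker_eq_bot.2 Subtype.val_injective)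
    let π : Y →ₗ[𝕜] Y := ((U 1).map C).subtype ∘ₗ p
    have hπ_mem (y) : π y ∈ (U 1).map C := (p y).2
    have hπ (y) (hy : y ∈ (U 1).map C) : π y = y :=
      congrArg Subtype.val (LinearMap.congr_fun hp ⟨y, hy⟩)
    -- On `(U 1).map C` this is `g`, which serves all deeper levels; `h` only corrects the remainder
    -- `y - π y`, for which landing in `U 0` is enough.
    refine ⟨g ∘ₗ π + h ∘ₗ (LinearMap.id - π), fun k hk y hy => ?_⟩
    cases k with
    | zero =>
      have h1 := hg 0 hN _ (hπ_mem y)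
      have h01 : U 1 ≤ U 0 := hU zero_le_one
      have h2 := hh _ (sub_mem hy (Submodule.map_mono h01 (hπ_mem y)))
      refine ⟨add_mem (h01 h1.1) h2.1, ?_⟩
      simp only [LinearMap.add_apply, LinearMap.comp_apply, LinearMap.sub_apply,
        LinearMap.id_apply, map_add]
      rw [h1.2, h2.2]
      abel
    | succ k =>
      have hy1 : π y = y := hπ y (Submodule.map_mono (hU (by omega)) hy)
      have := hg k (by omega) y hy
      simpa [hy1] using this

/-- Deadbeat observer: an output injection makes `A` nilpotent modulo the unobservable space. -/
theorem exists_deadbeat_observer [FiniteDimensional 𝕜 X] (A : X →ₗ[𝕜] X) (C : X →ₗ[𝕜] Y) :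
    ∃ (K : Y →ₗ[𝕜] X) (N : ℕ), ∀ x k, C ((A ^ k) (((A + K ∘ₗ C) ^ N) x)) = 0 := by
  -- The iterate `U k` consists of the states reached at time k by trajectories with zero output at
  -- all earlier times.
  let F : Submodule 𝕜 X → Submodule 𝕜 X := fun U => (U ⊓ LinearMap.ker C).map A
  have hF : Monotone F := fun U W h => Submodule.map_mono (inf_le_inf_right _ h)
  let U : ℕ → Submodule 𝕜 X := fun k => F^[k] ⊤
  have hUs (k) : U (k + 1) = F (U k) := Function.iterate_succ_apply' F k ⊤
  have hU : Antitone U := by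
    refine antitone_nat_of_succ_le fun k => ?_
    induction k with
    | zero => exact le_top
    | succ k ih =>
      rw [hUs (k + 1)]
      conv_rhs => rw [hUs k]
      exact hF ih
  obtain ⟨N, hN⟩ := IsArtinian.monotone_stabilizes (R := 𝕜) (M := X)
    ⟨fun k => OrderDual.toDual (U k), hU⟩
  have hst : U N = F (U N) := by
    rw [← hUs]; exact hN (N + 1) (Nat.le_succ N)
  -- `U N` is the image of `U N ⊓ ker C`, so a dimension count leaves no room outside `ker C`.
  have hker : U N ≤ LinearMap.ker C := by
    have h1 : Module.finrank 𝕜 (U N) ≤ Module.finrank 𝕜 (U N ⊓ LinearMap.ker C : Submodule 𝕜 X) := by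
      conv_lhs => rw [hst]
      exact Submodule.finrank_map_le _ _
    exact inf_eq_left.1 (Submodule.eq_of_le_of_finrank_le inf_le_left h1)
  have hinv (x) (hx : x ∈ U N) : A x ∈ U N := by
    rw [hst]
    exact ⟨x, ⟨hx, hker hx⟩, rfl⟩
  obtain ⟨g, hg⟩ := C.exists_section_map_chain N U hU
  -- With this gain w goes to A (w - g (C w)), and w - g (C w) stays in `U j` with zero output;
  -- hence each step descends one level of the chain.
  refine ⟨-(A ∘ₗ g), N, fun x k => ?_⟩
  have hmem : ∀ j ≤ N, ((A + -(A ∘ₗ g) ∘ₗ C) ^ j) x ∈ U j := by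
    intro j
    induction j with
    | zero => exact fun _ => Submodule.mem_top
    | succ j ih =>
      intro hj
      rw [pow_succ', Module.End.mul_apply, hUs]
      have h1 := ih (by omega)
      set w := ((A + -(A ∘ₗ g) ∘ₗ C) ^ j) x
      have h2 := hg j hj (C w) ⟨w, h1, rfl⟩
      refine ⟨w - g (C w), ⟨sub_mem h1 h2.1, ?_⟩, ?_⟩
      · simp [h2.2]
      · simp [sub_eq_add_neg]
  have hA : ∀ k, ∀ w ∈ U N, (A ^ k) w ∈ U N := by
    intro k
    induction k with
    | zero => exact fun w hw => hw
    | succ k ih =>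
      intro w hw
      rw [pow_succ', Module.End.mul_apply]
      exact hinv _ (ih w hw)
  exact hker (hA k _ (hmem N le_rfl))

end LinearMap

/-! ### Unobservable spaces and observer gains for matrices. -/

theorem mem_unobservableSpace_iff {p : Type*} {n : ℕ} {C : Matrix p (Fin n) ℝ}
    {A : Matrix (Fin n) (Fin n) ℝ} {x : EuclideanSpace ℝ (Fin n)} :
    x ∈ unobservableSpace C A ↔ ∀ k < n, matAct (C * A ^ k) x = 0 := by
  rw [unobservableSpace, LinearMap.mem_ker]
  constructor
  · intro h k hk
    ext a
    exact congrArg (fun v => v (⟨k, hk⟩, a)) h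
  · intro h
    ext ⟨k, a⟩
    exact congrArg (fun v => v a) (h k k.2)

theorem matAct_mul {p q r : Type*} [Fintype q] [DecidableEq q] [Fintype r] [DecidableEq r]
    (M : Matrix p q ℝ) (M' : Matrix q r ℝ) : matAct (M * M') = matAct M ∘ₗ matAct M' := by
  ext x a
  simp [Matrix.toLpLin_apply]

theorem matAct_add {p q : Type*} [Fintype q] [DecidableEq q] (M M' : Matrix p q ℝ) :
    matAct (M + M') = matAct M + matAct M' :=
  map_add Matrix.toEuclideanLin M M'

theorem matAct_add_mul_apply {p q r : Type*} [Fintype q] [DecidableEq q] [Fintype r]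
    [DecidableEq r] (M : Matrix p r ℝ) (K : Matrix p q ℝ) (C : Matrix q r ℝ)
    (x : EuclideanSpace ℝ r) :
    matAct (M + K * C) x = matAct M x + matAct K (matAct C x) := by
  rw [matAct_add, matAct_mul]
  rfl

theorem matAct_pow {n : ℕ} (A : Matrix (Fin n) (Fin n) ℝ) (k : ℕ) :
    matAct (A ^ k) = matAct A ^ k := by
  induction k with
  | zero => ext x a; simp
  | succ k ih => rw [pow_succ, pow_succ, matAct_mul, ih]; rfl

/-- By Cayley-Hamilton, the output and all its successors vanish on the unobservable space. -/
theorem matAct_mul_pow_eq_zero_of_mem {p : Type*} {n : ℕ} {C : Matrix p (Fin n) ℝ}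
    {A : Matrix (Fin n) (Fin n) ℝ} {x : EuclideanSpace ℝ (Fin n)}
    (hx : x ∈ unobservableSpace C A) (k : ℕ) : matAct (C * A ^ k) x = 0 := by
  rw [mem_unobservableSpace_iff] at hx
  have hdeg : ((Polynomial.X ^ k : Polynomial ℝ) %ₘ A.charpoly).degree < n := by
    have := Polynomial.degree_modByMonic_lt (Polynomial.X ^ k) A.charpoly_monic
    rwa [Matrix.charpoly_degree_eq_dim, Fintype.card_fin] at this
  -- The range `n + 1` also covers n = 0, where the remainder is 0 and its `natDegree` is not below
  -- n; the extra coefficient vanishes.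
  rw [Matrix.pow_eq_aeval_mod_charpoly, Polynomial.aeval_eq_sum_range' (n := n + 1)
    (Nat.lt_succ_of_le (Polynomial.natDegree_le_of_degree_le hdeg.le)),
    Matrix.mul_sum, matAct, map_sum, LinearMap.sum_apply]
  refine Finset.sum_eq_zero fun j hj => ?_
  rw [Matrix.mul_smul, map_smul, LinearMap.smul_apply]
  rcases (Nat.lt_succ_iff.1 (Finset.mem_range.1 hj)).lt_or_eq with h | rfl
  · rw [hx j h, smul_zero]
  · rw [Polynomial.coeff_eq_zero_of_degree_lt hdeg, zero_smul]

theorem matAct_mem_unobservableSpace {p : Type*} {n : ℕ} {C : Matrix p (Fin n) ℝ}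
    {A : Matrix (Fin n) (Fin n) ℝ} {x : EuclideanSpace ℝ (Fin n)}
    (hx : x ∈ unobservableSpace C A) : matAct A x ∈ unobservableSpace C A := by
  rw [mem_unobservableSpace_iff]
  intro k _
  have := matAct_mul_pow_eq_zero_of_mem hx (k + 1)
  rwa [pow_succ, ← Matrix.mul_assoc, matAct_mul] at this

theorem matAct_injection_mem_unobservableSpace {p : Type*} [Fintype p] [DecidableEq p] {n : ℕ}
    {C : Matrix p (Fin n) ℝ} {A : Matrix (Fin n) (Fin n) ℝ} (K : Matrix (Fin n) p ℝ)
    {x : EuclideanSpace ℝ (Fin n)} (hx : x ∈ unobservableSpace C A) :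
    matAct (A + K * C) x ∈ unobservableSpace C A := by
  have hC : matAct C x = 0 := by simpa using matAct_mul_pow_eq_zero_of_mem hx 0
  have : matAct (A + K * C) x = matAct A x := by
    rw [matAct_add_mul_apply, hC, map_zero, add_zero]
  rw [this]
  exact matAct_mem_unobservableSpace hx

theorem exists_gain_pow_mem_unobservableSpace {p : Type*} [Fintype p] [DecidableEq p] {n : ℕ}
    (C : Matrix p (Fin n) ℝ) (A : Matrix (Fin n) (Fin n) ℝ) :
    ∃ (K : Matrix (Fin n) p ℝ) (N : ℕ),
      ∀ x, (matAct (A + K * C) ^ N) x ∈ unobservableSpace C A := by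
  obtain ⟨K, N, h⟩ := (matAct A).exists_deadbeat_observer (matAct C)
  refine ⟨Matrix.toEuclideanLin.symm K, N, fun x => ?_⟩
  rw [mem_unobservableSpace_iff]
  intro k _
  have hK : matAct (Matrix.toEuclideanLin.symm K) = K := LinearEquiv.apply_symm_apply _ K
  rw [matAct_add, matAct_mul, matAct_mul, matAct_pow, hK]
  exact h x k

theorem JointlyObservable.eq_zero_of_forall_mem {m n : ℕ} {s : Fin m → ℕ}
    {C : ∀ i, Matrix (Fin (s i)) (Fin n) ℝ} {A : Matrix (Fin n) (Fin n) ℝ}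
    (h : JointlyObservable C A) {x : EuclideanSpace ℝ (Fin n)}
    (hx : ∀ i, x ∈ unobservableSpace (C i) A) : x = 0 := by
  have : x ∈ unobservableSpace (stackedOutput C) A := by
    rw [mem_unobservableSpace_iff]
    intro k hk
    ext ⟨i, a⟩
    exact congrArg (fun v => v a) (mem_unobservableSpace_iff.1 (hx i) k hk)
  rw [JointlyObservable, IsObservable] at h
  rwa [h, Submodule.mem_bot] at this

/-! ### Tools for strict contraction. -/

/-- Projected averages are strict contractions unless all the vectors agree with the result. -/
theorem eq_starProjection_average_of_le_norm {E ι : Type*} [NormedAddCommGroup E]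
    [InnerProductSpace ℝ E] (V : Submodule ℝ E) [V.HasOrthogonalProjection] {s : Finset ι}
    (hs : s.Nonempty) {z : ι → E} {M : ℝ} (hz : ∀ j ∈ s, ‖z j‖ ≤ M)
    (hM : M ≤ ‖V.starProjection ((1 / (s.card : ℝ)) • ∑ j ∈ s, z j)‖) :
    ∀ j ∈ s, z j = V.starProjection ((1 / (s.card : ℝ)) • ∑ j ∈ s, z j) := by
  set v := (1 / (s.card : ℝ)) • ∑ j ∈ s, z j with hv
  set u := V.starProjection v with hu
  have hc : (s.card : ℝ) ≠ 0 := by exact_mod_cast hs.card_pos.ne'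
  have huv : inner ℝ u v = ‖u‖ ^ 2 := by
    have h0 : inner ℝ u (v - u) = 0 :=
      V.inner_right_of_mem_orthogonal (V.starProjection_apply_mem v)
        (V.sub_starProjection_mem_orthogonal v)
    rw [inner_sub_right, real_inner_self_eq_norm_sq] at h0
    linarith
  have hsum : ∑ j ∈ s, inner ℝ u (z j) = s.card * ‖u‖ ^ 2 := by
    rw [← huv, hv, inner_smul_right, inner_sum]
    field_simp
  have hterm (j) (hj : j ∈ s) : ‖u - z j‖ ^ 2 ≤ 2 * ‖u‖ ^ 2 - 2 * inner ℝ u (z j) := by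
    have h1 : ‖z j‖ ≤ ‖u‖ := (hz j hj).trans hM
    have h2 : ‖z j‖ ^ 2 ≤ ‖u‖ ^ 2 := by gcongr
    rw [norm_sub_sq_real]
    linarith
  -- The bounds in `hterm` sum to zero, because the inner products ⟨u, z j⟩ average to ‖u‖².
  have hle : ∑ j ∈ s, ‖u - z j‖ ^ 2 ≤ 0 := by
    refine (Finset.sum_le_sum hterm).trans ?_
    rw [Finset.sum_sub_distrib, ← Finset.mul_sum, ← Finset.mul_sum, hsum, Finset.sum_const, nsmul_eq_mul]
    linarith
  have heq := (Finset.sum_eq_zero_iff_of_nonneg fun j _ => sq_nonneg ‖u - z j‖).1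
    (le_antisymm hle (Finset.sum_nonneg fun j _ => sq_nonneg _))
  intro j hj
  have := heq j hj
  rw [sq_eq_zero_iff, norm_eq_zero, sub_eq_zero] at this
  exact this.symm

/-- The norm of `f` attains its maximum on the compact unit sphere, so the pointwise strict bound
becomes uniform. -/
theorem ContinuousLinearMap.opNorm_lt_one_of_forall_norm_lt {E F : Type*} [NormedAddCommGroup E]
    [NormedSpace ℝ E] [FiniteDimensional ℝ E] [NormedAddCommGroup F] [NormedSpace ℝ F]
    (f : E →L[ℝ] F) (h : ∀ z ≠ 0, ‖f z‖ < ‖z‖) : ‖f‖ < 1 := by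
  rcases (Metric.sphere (0 : E) 1).eq_empty_or_nonempty with he | hne
  · refine lt_of_le_of_lt (f.opNorm_le_of_unit_norm le_rfl fun z hz => ?_) zero_lt_one
    exact absurd (mem_sphere_zero_iff_norm.2 hz) (he ▸ Set.notMem_empty z)
  · have : ProperSpace E := FiniteDimensional.proper ℝ E
    obtain ⟨w, hw, hmax⟩ := (isCompact_sphere (0 : E) 1).exists_isMaxOn hne
      f.continuous.norm.continuousOn
    rw [mem_sphere_zero_iff_norm] at hw
    have hw0 : w ≠ 0 := norm_ne_zero_iff.1 (by rw [hw]; exact one_ne_zero)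
    refine lt_of_le_of_lt (f.opNorm_le_of_unit_norm (norm_nonneg (f w)) fun z hz => ?_)
      (hw ▸ h w hw0)
    exact hmax (mem_sphere_zero_iff_norm.2 hz)

theorem tendsto_norm_pow_zero_of_norm_pow_lt_one {R : Type*} [NormedRing R] [NormOneClass R]
    {a : R} {T : ℕ} (hT : ‖a ^ T‖ < 1) (ha : ‖a‖ ≤ 1) :
    Tendsto (fun q => ‖a ^ q‖) atTop (nhds 0) := by
  have hanti : Antitone fun q => ‖a ^ q‖ := antitone_nat_of_succ_le fun q => by
    rw [pow_succ]
    exact (norm_mul_le _ _).trans (mul_le_of_le_one_right (norm_nonneg _) ha)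
  have hlim := tendsto_pow_atTop_nhds_zero_of_lt_one (norm_nonneg _) hT
  rw [Metric.tendsto_atTop] at hlim ⊢
  intro ε hε
  obtain ⟨p, hp⟩ := hlim ε hε
  refine ⟨T * p, fun q hq => ?_⟩
  have h1 := hp p le_rfl
  rw [Real.dist_0_eq_abs, abs_of_nonneg (by positivity)] at h1 ⊢
  calc ‖a ^ q‖ ≤ ‖a ^ (T * p)‖ := hanti hq
    _ = ‖(a ^ T) ^ p‖ := by rw [pow_mul]
    _ ≤ ‖a ^ T‖ ^ p := norm_pow_le _ _
    _ < ε := h1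

/-! ### Walks in neighbor graphs. -/

/-- There is a walk of length `k` from `j` to `i`. -/
def NeighborGraph.Walk {m : ℕ} (N : NeighborGraph m) : ℕ → Fin m → Fin m → Prop
  | 0, j, i => j = i
  | k + 1, j, i => ∃ l, N.Arc j l ∧ NeighborGraph.Walk N k l i

theorem NeighborGraph.Walk.succ {m : ℕ} {N : NeighborGraph m} {k : ℕ} {j i : Fin m}
    (h : N.Walk k j i) : N.Walk (k + 1) j i :=
  ⟨j, N.self_mem j, h⟩

/-- Self-arcs pad walks to any greater length, so one length serves all the finitely many pairs. -/
theorem NeighborGraph.StronglyConnected.exists_walk {m : ℕ} {N : NeighborGraph m}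
    (h : N.StronglyConnected) : ∃ T, ∀ j i, N.Walk T j i := by
  have hex (ji : Fin m × Fin m) : ∀ᶠ T in atTop, N.Walk T ji.1 ji.2 := by
    obtain ⟨j, i⟩ := ji
    have : ∃ k, N.Walk k j i := by
      induction h j i using Relation.ReflTransGen.head_induction_on with
      | refl => exact ⟨0, rfl⟩
      | head hab _ ih => exact ih.elim fun k hk => ⟨k + 1, _, hab, hk⟩
    obtain ⟨k, hk⟩ := this
    refine eventually_atTop.2 ⟨k, fun T hT => ?_⟩
    induction T, hT using Nat.le_induction with
    | base => exact hk
    | succ T _ ih => exact ih.succ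
  obtain ⟨T, hT⟩ := (eventually_all.2 hex).exists
  exact ⟨T, fun j i => hT (j, i)⟩

instance NeighborGraph.instFinite (m : ℕ) : Finite (NeighborGraph m) :=
  Finite.of_injective NeighborGraph.nbr fun ⟨_, _⟩ ⟨_, _⟩ h => by
    cases h
    rfl

/-! ### Contraction of iterated projected averages. -/

/-- Every component is replaced by the projection of the average over its neighbors. -/
noncomputable def projectedAverage {m : ℕ} {E : Type*} [NormedAddCommGroup E] [InnerProductSpace ℝ E]
    (V : Fin m → Submodule ℝ E) [∀ i, (V i).HasOrthogonalProjection] (N : NeighborGraph m) :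
    (Fin m → E) →L[ℝ] (Fin m → E) :=
  ContinuousLinearMap.pi fun i =>
    (V i).starProjection ∘L
      ((1 / ((N.nbr i).card : ℝ)) • ∑ j ∈ N.nbr i, ContinuousLinearMap.proj j)

section ProjectedAverage

variable {m : ℕ} {E : Type*} [NormedAddCommGroup E] [InnerProductSpace ℝ E]
  (V : Fin m → Submodule ℝ E) [∀ i, (V i).HasOrthogonalProjection] (N : NeighborGraph m)

theorem projectedAverage_apply (z : Fin m → E) (i : Fin m) :
    projectedAverage V N z i =
      (V i).starProjection ((1 / ((N.nbr i).card : ℝ)) • ∑ j ∈ N.nbr i, z j) := by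
  simp [projectedAverage]

theorem projectedAverage_mem (z : Fin m → E) (i : Fin m) : projectedAverage V N z i ∈ V i := by
  rw [projectedAverage_apply]
  exact (V i).starProjection_apply_mem _

variable {V N} in
theorem projectedAverage_eq_of_le_norm {z : Fin m → E} {M : ℝ} (hz : ‖z‖ ≤ M) {i : Fin m}
    (hM : M ≤ ‖projectedAverage V N z i‖) : ∀ j ∈ N.nbr i, z j = projectedAverage V N z i := by
  rw [projectedAverage_apply] at hM ⊢
  exact eq_starProjection_average_of_le_norm (V i) ⟨i, N.self_mem i⟩
    (fun j _ => (norm_le_pi_norm z j).trans hz) hM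

theorem norm_projectedAverage_apply_le (z : Fin m → E) : ‖projectedAverage V N z‖ ≤ ‖z‖ := by
  refine (pi_norm_le_iff_of_nonneg (norm_nonneg z)).2 fun i => ?_
  by_contra! h
  -- A component longer than ‖z‖ falls under the equality case, and the self-arc forces it to equal
  -- `z i`.
  have := projectedAverage_eq_of_le_norm le_rfl h.le i (N.self_mem i)
  exact absurd (norm_le_pi_norm z i) (not_le.2 (this ▸ h))

theorem norm_projectedAverage_le : ‖projectedAverage V N‖ ≤ 1 :=
  ContinuousLinearMap.opNorm_le_bound _ zero_le_one fun z => by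
    rw [one_mul]
    exact norm_projectedAverage_apply_le V N z

theorem norm_projectedAverage_pow_apply_le (k : ℕ) (z : Fin m → E) :
    ‖(projectedAverage V N ^ k) z‖ ≤ ‖z‖ := by
  induction k with
  | zero => exact le_rfl
  | succ k ih =>
    rw [pow_succ', mul_apply_eq_comp]
    exact (norm_projectedAverage_apply_le V N _).trans ih

variable {V N} in
/-- If a component has not lost any norm after `k` rounds, it agrees with the initial values of all
the components from which it can be reached in `k` rounds. -/
theorem eq_projectedAverage_pow_of_walk (k : ℕ) {z : Fin m → E} {i : Fin m}
    (h : ‖z‖ ≤ ‖(projectedAverage V N ^ k) z i‖) {j : Fin m} (hj : N.Walk k j i) :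
    z j = (projectedAverage V N ^ k) z i := by
  induction k generalizing z j with
  | zero => cases hj; rfl
  | succ k ih =>
    obtain ⟨l, hjl, hl⟩ := hj
    rw [pow_succ, mul_apply_eq_comp] at h ⊢
    have h1 := ih ((norm_projectedAverage_apply_le V N z).trans h) hl
    rw [← h1] at h ⊢
    exact projectedAverage_eq_of_le_norm le_rfl h j hjl

variable {V N} in
-- If component i keeps the full norm, walks from all j make z constant. The one round beyond T puts
-- the common value in every `V j`: after the first round component j already lies in `V j`, and T
-- more rounds identify it with that value.
theorem exists_norm_projectedAverage_pow_lt_one [FiniteDimensional ℝ E]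
    (hV : ∀ x, (∀ i, x ∈ V i) → x = 0) (hN : N.StronglyConnected) :
    ∃ T, ‖projectedAverage V N ^ T‖ < 1 := by
  obtain ⟨T, hT⟩ := hN.exists_walk
  refine ⟨T + 1, ContinuousLinearMap.opNorm_lt_one_of_forall_norm_lt _ fun z hz => ?_⟩
  refine (pi_norm_lt_iff (norm_pos_iff.2 hz)).2 fun i => ?_
  by_contra! h
  have hall (j) : z j = (projectedAverage V N ^ (T + 1)) z i :=
    eq_projectedAverage_pow_of_walk (T + 1) h (hT j i).succ
  have hmem (j) : (projectedAverage V N ^ (T + 1)) z i ∈ V j := by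
    rw [pow_succ, mul_apply_eq_comp] at h ⊢
    rw [← eq_projectedAverage_pow_of_walk T
      ((norm_projectedAverage_apply_le V N z).trans h) (hT j i)]
    exact projectedAverage_mem V N z j
  exact hz (funext fun j => (hall j).trans (hV _ hmem))

theorem eventually_norm_projectedAverage_pow_le [FiniteDimensional ℝ E]
    (hV : ∀ x, (∀ i, x ∈ V i) → x = 0) {ε : ℝ} (hε : 0 < ε) :
    ∀ᶠ q in atTop, ∀ N : NeighborGraph m, N.StronglyConnected →
      ∀ z, ‖(projectedAverage V N ^ q) z‖ ≤ ε * ‖z‖ := by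
  refine eventually_all.2 fun N => ?_
  by_cases hN : N.StronglyConnected
  · obtain ⟨T, hT⟩ := exists_norm_projectedAverage_pow_lt_one hV hN
    -- The trivial space is set apart because there the identity operator does not have norm one.
    rcases subsingleton_or_nontrivial (Fin m → E) with hsub | hnt
    · refine Eventually.of_forall fun q _ z => ?_
      rw [Subsingleton.elim ((projectedAverage V N ^ q) z) 0, norm_zero]
      positivity
    · filter_upwards [(tendsto_norm_pow_zero_of_norm_pow_lt_one (a := projectedAverage V N) hT
        (norm_projectedAverage_le V N)).eventually (ge_mem_nhds hε)] with q hq _ z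
      exact ContinuousLinearMap.le_of_opNorm_le _ hq z
  · exact Eventually.of_forall fun q h => absurd h hN

end ProjectedAverage

/-! ### Error dynamics of the estimator. -/

section Consensus

variable {m n : ℕ} {s : Fin m → ℕ} {A : Matrix (Fin n) (Fin n) ℝ}
  {C : ∀ i, Matrix (Fin (s i)) (Fin n) ℝ} (N : NeighborGraph m)

/-- Averaging preserves constant tuples, so estimation errors obey the same consensus recursion as
the estimates. -/
theorem consensusStep_sub_const (x : EuclideanSpace ℝ (Fin n))
    (z : Fin m → EuclideanSpace ℝ (Fin n)) :
    consensusStep A C N (fun i => z i - x) = fun i => consensusStep A C N z i - x := by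
  funext i
  have hc : ((N.nbr i).card : ℝ) ≠ 0 := by
    exact_mod_cast (Finset.card_pos.2 ⟨i, N.self_mem i⟩).ne'
  simp only [consensusStep, Finset.sum_sub_distrib, Finset.sum_const, map_sub,
    smul_sub, ← Nat.cast_smul_eq_nsmul ℝ, one_div]
  rw [map_smul, smul_smul, inv_mul_cancel₀ hc, one_smul]
  abel

theorem consensusStep_iterate_sub_const (q : ℕ) (x : EuclideanSpace ℝ (Fin n))
    (z : Fin m → EuclideanSpace ℝ (Fin n)) :
    (consensusStep A C N)^[q] (fun i => z i - x) =
      fun i => (consensusStep A C N)^[q] z i - x := by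
  induction q with
  | zero => rfl
  | succ q ih => simp only [Function.iterate_succ_apply', ih, consensusStep_sub_const]

theorem consensusStep_iterate_sub_mem (q : ℕ) (z : Fin m → EuclideanSpace ℝ (Fin n)) (i : Fin m) :
    (consensusStep A C N)^[q] z i - z i ∈ unobservableSpace (C i) A := by
  induction q with
  | zero => simp
  | succ q ih =>
    rw [Function.iterate_succ_apply']
    set w := (consensusStep A C N)^[q] z
    have h : consensusStep A C N w i - z i = (w i - z i) +
        (-(unobservableSpace (C i) A).starProjection (w i) + (1 / ((N.nbr i).card : ℝ)) •
          (unobservableSpace (C i) A).starProjection (∑ j ∈ N.nbr i, w j)) := by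
      rw [consensusStep]
      abel
    rw [h]
    exact add_mem ih (add_mem (neg_mem (Submodule.starProjection_apply_mem _ _))
      (Submodule.smul_mem _ _ (Submodule.starProjection_apply_mem _ _)))

theorem consensusStep_iterate_eq_projectedAverage_pow (q : ℕ)
    {z : Fin m → EuclideanSpace ℝ (Fin n)} (hz : ∀ i, z i ∈ unobservableSpace (C i) A) :
    (consensusStep A C N)^[q] z =
      (projectedAverage (fun i => unobservableSpace (C i) A) N ^ q) z := by
  induction q with
  | zero => rfl
  | succ q ih =>
    have hmem (i) : (consensusStep A C N)^[q] z i ∈ unobservableSpace (C i) A := by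
      simpa using add_mem (consensusStep_iterate_sub_mem (A := A) (C := C) N q z i) (hz i)
    rw [Function.iterate_succ_apply', pow_succ', mul_apply_eq_comp, ← ih]
    funext i
    rw [projectedAverage_apply, consensusStep,
      Submodule.starProjection_eq_self_iff.2 (hmem i), sub_self, zero_add, map_smul]

theorem IsEstimatorRun.error_succ {K : ∀ i, Matrix (Fin n) (Fin (s i)) ℝ} {q : ℕ}
    {N : ℕ → NeighborGraph m} {x : ℕ → EuclideanSpace ℝ (Fin n)}
    {xh : ℕ → Fin m → EuclideanSpace ℝ (Fin n)} (h : IsEstimatorRun A C K q N x xh)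
    (τ : ℕ) (i : Fin m) :
    xh (τ + 1) i - x (τ + 1) = matAct (A + K i * C i)
      ((consensusStep A C (N τ))^[q] (fun i => xh τ i - x τ) i) := by
  rw [consensusStep_iterate_sub_const, h.plant, h.update, map_sub, sub_sub]
  congr 1
  rw [matAct_add_mul_apply, add_comm]

/-- Modulo the invariant unobservable space, neither the consensus rounds nor the graph affects the
local observer. -/
theorem IsEstimatorRun.error_sub_pow_mem {K : ∀ i, Matrix (Fin n) (Fin (s i)) ℝ} {q : ℕ}
    {N : ℕ → NeighborGraph m} {x : ℕ → EuclideanSpace ℝ (Fin n)}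
    {xh : ℕ → Fin m → EuclideanSpace ℝ (Fin n)} (h : IsEstimatorRun A C K q N x xh)
    (τ : ℕ) (i : Fin m) :
    xh τ i - x τ - (matAct (A + K i * C i) ^ τ) (xh 0 i - x 0) ∈ unobservableSpace (C i) A := by
  induction τ with
  | zero => simp
  | succ τ ih =>
    rw [h.error_succ, pow_succ', Module.End.mul_apply, ← map_sub]
    apply matAct_injection_mem_unobservableSpace
    simpa using add_mem
      (consensusStep_iterate_sub_mem (A := A) (C := C) (N τ) q (fun i => xh τ i - x τ) i) ih

end Consensus

/-! ### Decay rate and conclusion. -/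

/-- A sequence that eventually contracts by the factor `r` at each step is `O(r ^ τ)`. -/
theorem isBigO_pow_of_eventually_norm_succ_le {E : Type*} [SeminormedAddCommGroup E] {u : ℕ → E}
    {r : ℝ} (hr : r ≠ 0) {T : ℕ} (h : ∀ τ ≥ T, ‖u (τ + 1)‖ ≤ |r| * ‖u τ‖) :
    u =O[atTop] fun τ => r ^ τ := by
  have hr' : 0 < |r| := abs_pos.2 hr
  refine IsBigO.of_bound (‖u T‖ / |r| ^ T) (eventually_atTop.2 ⟨T, fun τ hτ => ?_⟩)
  rw [norm_pow, Real.norm_eq_abs]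
  induction τ, hτ using Nat.le_induction with
  | base => rw [div_mul_cancel₀ _ (by positivity)]
  | succ τ hτ ih =>
    calc ‖u (τ + 1)‖ ≤ |r| * ‖u τ‖ := h τ hτ
      _ ≤ |r| * (‖u T‖ / |r| ^ T * |r| ^ τ) := by gcongr
      _ = ‖u T‖ / |r| ^ T * |r| ^ (τ + 1) := by ring

theorem exists_gain_eventually_isBigO {m n : ℕ} {s : Fin m → ℕ} {A : Matrix (Fin n) (Fin n) ℝ}
    {C : ∀ i, Matrix (Fin (s i)) (Fin n) ℝ} (hobs : JointlyObservable C A)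
    {lam : ℝ} (hlam : lam ≠ 0) :
    ∃ K : ∀ i, Matrix (Fin n) (Fin (s i)) ℝ, ∃ q₀ : ℕ, ∀ q : ℕ, q₀ ≤ q →
      ∀ N : ℕ → NeighborGraph m, (∀ τ, (N τ).StronglyConnected) →
        ∀ (x : ℕ → EuclideanSpace ℝ (Fin n)) (xh : ℕ → Fin m → EuclideanSpace ℝ (Fin n)),
          IsEstimatorRun A C K q N x xh →
            ∀ i, (fun τ => xh τ i - x τ) =O[atTop] (fun τ : ℕ => lam ^ τ) := by
  choose K T hKT using fun i => exists_gain_pow_mem_unobservableSpace (C i) A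
  refine ⟨K, ?_⟩
  let B : Fin m → EuclideanSpace ℝ (Fin n) →L[ℝ] EuclideanSpace ℝ (Fin n) :=
    fun i => LinearMap.toContinuousLinearMap (matAct (A + K i * C i))
  -- Adding 1 keeps the divisor positive even when all the maps `B i` vanish.
  have hb : 0 < ‖B‖ + 1 := by positivity
  have hlam' : 0 < |lam| := abs_pos.2 hlam
  obtain ⟨q₀, hq₀⟩ := eventually_atTop.1 (eventually_norm_projectedAverage_pow_le
    (fun i => unobservableSpace (C i) A) (fun x hx => hobs.eq_zero_of_forall_mem hx)
    (div_pos hlam' hb))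
  refine ⟨q₀, fun q hq N hN x xh hrun => ?_⟩
  -- The sum is a convenient common bound for all the deadbeat times.
  have hmem : ∀ τ ≥ ∑ i, T i, ∀ i, xh τ i - x τ ∈ unobservableSpace (C i) A := by
    intro τ hτ i
    have hTi : T i ≤ τ := (Finset.single_le_sum (fun _ _ => Nat.zero_le _)
      (Finset.mem_univ i)).trans hτ
    have h1 := hKT i ((matAct (A + K i * C i) ^ (τ - T i)) (xh 0 i - x 0))
    rw [← Module.End.mul_apply, ← pow_add, Nat.add_sub_cancel' hTi] at h1
    simpa using add_mem (hrun.error_sub_pow_mem τ i) h1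
  have hO : (fun τ i => xh τ i - x τ) =O[atTop] fun τ : ℕ => lam ^ τ := by
    refine isBigO_pow_of_eventually_norm_succ_le hlam (T := ∑ i, T i) fun τ hτ => ?_
    refine (pi_norm_le_iff_of_nonneg (by positivity)).2 fun i => ?_
    set e : Fin m → EuclideanSpace ℝ (Fin n) := fun i => xh τ i - x τ
    rw [hrun.error_succ, consensusStep_iterate_eq_projectedAverage_pow _ q (hmem τ hτ)]
    set w := (projectedAverage (fun i => unobservableSpace (C i) A) (N τ) ^ q) e with hw
    calc ‖B i (w i)‖ ≤ ‖B i‖ * ‖w i‖ := (B i).le_opNorm _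
      _ ≤ (‖B‖ + 1) * (|lam| / (‖B‖ + 1) * ‖e‖) := by
        gcongr
        · exact (norm_le_pi_norm B i).trans (le_add_of_nonneg_right zero_le_one)
        · exact (norm_le_pi_norm w i).trans (hq₀ q hq (N τ) (hN τ) e)
      _ = |lam| * ‖e‖ := by field_simp
  exact fun i => isBigO_pi.1 hO i

theorem theorem4 (m n : ℕ) (s : Fin m → ℕ) (A : Matrix (Fin n) (Fin n) ℝ)
    (C : ∀ i, Matrix (Fin (s i)) (Fin n) ℝ) (hobs : JointlyObservable C A)
    (lam : ℝ) (hlam0 : lam ≠ 0) (hlam1 : |lam| < 1) :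
    ∃ K : ∀ i, Matrix (Fin n) (Fin (s i)) ℝ,
      -- fixed neighbor graph
      (∀ N : NeighborGraph m, N.StronglyConnected →
        ∃ q₀ : ℕ, ∀ q : ℕ, q₀ ≤ q →
          ∀ (x : ℕ → EuclideanSpace ℝ (Fin n)) (xh : ℕ → Fin m → EuclideanSpace ℝ (Fin n)),
            IsEstimatorRun A C K q (fun _ => N) x xh →
              ∀ i, (fun τ => xh τ i - x τ) =O[atTop] (fun τ : ℕ => lam ^ τ)) ∧
      -- time-varying neighbor graph, with one threshold for all graph sequences
      (∃ q₀ : ℕ, ∀ q : ℕ, q₀ ≤ q →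
        ∀ N : ℕ → NeighborGraph m, (∀ τ, (N τ).StronglyConnected) →
          ∀ (x : ℕ → EuclideanSpace ℝ (Fin n)) (xh : ℕ → Fin m → EuclideanSpace ℝ (Fin n)),
            IsEstimatorRun A C K q N x xh →
              ∀ i, (fun τ => xh τ i - x τ) =O[atTop] (fun τ : ℕ => lam ^ τ)) := by
  obtain ⟨K, q₀, h⟩ := exists_gain_eventually_isBigO hobs hlam0
  -- A fixed graph is a constant sequence, so the uniform threshold covers it too.
  exact ⟨K, fun N hN => ⟨q₀, fun q hq => h q hq (fun _ => N) fun _ => hN⟩, q₀, h⟩
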